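/- Let $p$ be a positive integer, let $X=(X_1,\ldots,X_p)$ and $\widetilde X=(\widetilde X_1,\ldots,\widetilde X_p)$ be random vectors in $\mathbb{R}^p$ and $Y$ a real random variable, all on the same probability space. Suppose that $\widetilde X$ is a knockoff copy of $X$, that is: (i) for each $i\in\{1,\ldots,p\}$, the law of $(X,\widetilde X)$ on $\mathbb{R}^{2p}$ does not change when its $i$-th and its $(p+i)$-th coordinates are swapped; and (ii) $\widetilde X$ is conditionally independent of $Y$ given $X$. Then the following two conditions are equivalent. (a) $\widetilde X$ is a conditional independence knockoff of $X$: there are a measurable space $\Theta$, a probability measure $\gamma$ on $\Theta$ and, for each $i=1,\ldots,p$, a Markov kernel $P_i(\cdot\mid\theta)$ from $\Theta$ to $\mathbb{R}$ such that $$P(X_1\in A_1,\ldots,X_p\in A_p,\widetilde X_1\in B_1,\ldots,\widetilde X_p\in B_p)=\int_\Theta\prod_{i=1}^p P_i(A_i\mid\theta)\,P_i(B_i\mid\theta)\,\gamma(d\theta)$$ for all Borel sets $A_1,\ldots,A_p,B_1,\ldots,B_p\subset\mathbb{R}$. (b) $(X,\widetilde X)$ is infinitely extendable: there is, on some probability space,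 an infinite sequence $V=(V_1,V_2,\ldots)$ of real random variables such that $(V_1,\ldots,V_{2p})\sim(X,\widetilde X)$ and, for all integers $1\le i\le p$ and $j,k\ge 0$, the sequence obtained from $V$ by swapping $V_{kp+i}$ with $V_{jp+i}$ and leaving all other elements fixed has the same law as $V$. -/

import Mathlib

open MeasureTheory ProbabilityTheory

universe u v w

/-- The vector `(X, X̃)` of `ℝ^{2p}`: its coordinate `i` is `X_i` and its coordinate `p + i`
is `X̃_i`, for `i = 0, …, p - 1`. -/
def joinVec {Ω : Type u} {p : ℕ} (X Xt : Ω → Fin p → ℝ) : Ω → Fin (p + p) → ℝ :=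
  fun ω => Fin.append (X ω) (Xt ω)

/-- The map `f_i : ℝ^{2p} → ℝ^{2p}` that swaps the coordinates `i` and `p + i` and leaves all
other coordinates fixed. -/
def swapCoord {p : ℕ} (i : Fin p) (x : Fin (p + p) → ℝ) : Fin (p + p) → ℝ :=
  fun r => x (Equiv.swap (Fin.castAdd p i) (Fin.natAdd p i) r)

/-- Conditional independence of the random elements `U` and `W` given the random element `T`:
`P(U ∈ s, W ∈ t | T) = P(U ∈ s | T) P(W ∈ t | T)` almost surely, for all measurable `s`, `t`.
No assumption on the underlying probability space is needed. -/
def CondIndepGiven {Ω : Type u} [MeasurableSpace Ω] {α β γ : Type*} [MeasurableSpace α]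
    [MeasurableSpace β] [mγ : MeasurableSpace γ] (U : Ω → α) (W : Ω → β) (T : Ω → γ)
    (μ : Measure Ω) : Prop :=
  ∀ (s : Set α) (t : Set β), MeasurableSet s → MeasurableSet t →
    μ⟦U ⁻¹' s ∩ W ⁻¹' t | mγ.comap T⟧ =ᵐ[μ]
      μ⟦U ⁻¹' s | mγ.comap T⟧ * μ⟦W ⁻¹' t | mγ.comap T⟧

/-- `Xt` is a knockoff copy of the vector `X` of explanatory variables, `Y` being the response
variable. -/
structure IsKnockoff {Ω : Type u} [MeasurableSpace Ω] {p : ℕ} (X Xt : Ω → Fin p → ℝ)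
    (Y : Ω → ℝ) (μ : Measure Ω) : Prop where
  /-- `f_i (X, X̃) ∼ (X, X̃)` for each `i`. -/
  swap_invariant : ∀ i : Fin p,
    IdentDistrib (fun ω => swapCoord i (joinVec X Xt ω)) (joinVec X Xt) μ μ
  /-- `X̃` is independent of `Y` given `X`. -/
  condIndep : CondIndepGiven Xt Y X μ

/-- `Xt` is a conditional independence knockoff of `X`: there are a measurable space `Θ`, a
probability measure `γ` on `Θ` and Markov kernels `P_i(· | θ)` from `Θ` to `ℝ` with
`P(X_i ∈ A_i, X̃_i ∈ B_i for all i) = ∫ ∏_i P_i(A_i | θ) P_i(B_i | θ) γ(dθ)`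
for all Borel sets `A_i`, `B_i`. -/
def IsCIK {Ω : Type u} [MeasurableSpace Ω] {p : ℕ} (X Xt : Ω → Fin p → ℝ)
    (μ : Measure Ω) : Prop :=
  ∃ (Θ : Type w) (_ : MeasurableSpace Θ) (γ : Measure Θ) (P : Fin p → Kernel Θ ℝ),
    IsProbabilityMeasure γ ∧ (∀ i, IsMarkovKernel (P i)) ∧
    ∀ A B : Fin p → Set ℝ, (∀ i, MeasurableSet (A i)) → (∀ i, MeasurableSet (B i)) →
      μ {ω | (∀ i, X ω i ∈ A i) ∧ (∀ i, Xt ω i ∈ B i)} =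
        ∫⁻ θ, ∏ i, (P i θ (A i) * P i θ (B i)) ∂γ

/-- The sequence obtained from `x` by swapping the elements of indices `k p + i` and `j p + i`
and leaving all other elements fixed. Sequences and positions `i` are numbered from `0`. -/
def swapSeq {p : ℕ} (i : Fin p) (j k : ℕ) (x : ℕ → ℝ) : ℕ → ℝ :=
  fun r => x (Equiv.swap (k * p + i) (j * p + i) r)

/-- `(X, Xt)` is infinitely extendable: on some probability space there is an infinite sequence
`V` of real random variables whose first `2p` elements are distributed as `(X, Xt)` and whose
law is invariant under all the swaps `swapSeq i j k`. -/
def InfinitelyExtendable {Ω : Type u} [MeasurableSpace Ω] {p : ℕ} (X Xt : Ω → Fin p → ℝ)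
    (μ : Measure Ω) : Prop :=
  ∃ (Ω' : Type v) (_ : MeasurableSpace Ω') (ν : Measure Ω') (V : Ω' → ℕ → ℝ),
    IsProbabilityMeasure ν ∧ Measurable V ∧
    IdentDistrib (fun ω (r : Fin (p + p)) => V ω r) (joinVec X Xt) ν μ ∧
    ∀ (i : Fin p) (j k : ℕ), IdentDistrib (fun ω => swapSeq i j k (V ω)) V ν ν

/-! This is de Finetti's theorem carried out separately on each residue class modulo `p`.

From a mixture, continue the kernels `p`-periodically and draw all elements independently given `θ`.
Swapping two positions of equal residue does not change the law.

Conversely, let `L` be the law of `V`. Invariance under swaps upgrades to invariance under every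
injective, residue-preserving re-indexing, in particular under shifting all indices beyond `r` by
`2p`. So `(x_r, future after r)` and `(x_r, future after r + 2p)` have the same law; by an L²
argument (`condExp_ae_eq_of_map_prodMk_eq`) the extra coordinates add no information on `x_r`. Hence
for `r < 2p` conditioning `x_r` on everything after it is the same as conditioning on the
coordinates from `2p` on. Peeling off one coordinate at a time makes the first `2p` coordinates
conditionally independent given those from `2p` on, and a swap of `r` with `r % p` shows that their
conditional laws depend only on the residue. No limit or tail σ-algebra is needed: the block from
`2p` on plays the role of `θ`. -/

/-- Probability measures on a product of real lines agree as soon as they agree on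
finite-dimensional boxes. -/
theorem ext_of_finset_pi {ι : Type*} {μ ν : Measure (ι → ℝ)} [IsProbabilityMeasure μ]
    [IsProbabilityMeasure ν]
    (h : ∀ (s : Finset ι) (t : ι → Set ℝ), (∀ i, MeasurableSet (t i)) →
      μ ((s : Set ι).pi t) = ν ((s : Set ι).pi t)) : μ = ν := by
  refine ext_of_generate_finite _ generateFrom_squareCylinders.symm
    (isPiSystem_squareCylinders (fun _ => MeasurableSpace.isPiSystem_measurableSet) (by simp))
    ?_ (by simp)
  rintro _ ⟨s, t, ht, rfl⟩
  exact h s t fun i => ht i (Set.mem_univ i)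

theorem ext_of_univ_pi {ι : Type*} [Fintype ι] {μ ν : Measure (ι → ℝ)} [IsProbabilityMeasure μ]
    [IsProbabilityMeasure ν]
    (h : ∀ t : ι → Set ℝ, (∀ i, MeasurableSet (t i)) →
      μ (Set.univ.pi t) = ν (Set.univ.pi t)) : μ = ν := by
  refine ext_of_generate_finite _ generateFrom_pi.symm isPiSystem_pi ?_ (by simp)
  rintro _ ⟨t, ht, rfl⟩
  exact h t fun i => ht i (Set.mem_univ i)

/-! ### Redundant information in conditional laws -/

/-- If `(T₁, Z)` and `(T₂, Z)` have the same law and `T₂` carries less information than `T₁`, then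
the conditional laws of `Z` given `T₁` and given `T₂` coincide. -/
theorem condExp_ae_eq_of_map_prodMk_eq {Ω S α : Type*} {mΩ : MeasurableSpace Ω}
    [mS : MeasurableSpace S] [MeasurableSpace α] [StandardBorelSpace α] [Nonempty α]
    {μ : Measure Ω} [IsProbabilityMeasure μ] {Z : Ω → α} {T₁ T₂ : Ω → S} (hZ : Measurable Z)
    (hT₁ : Measurable T₁) (hT₂ : Measurable T₂)
    (hmap : μ.map (fun ω => (T₁ ω, Z ω)) = μ.map (fun ω => (T₂ ω, Z ω)))
    (hle : mS.comap T₂ ≤ mS.comap T₁) {s : Set α} (hs : MeasurableSet s) :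
    μ⟦Z ⁻¹' s | mS.comap T₁⟧ =ᵐ[μ] μ⟦Z ⁻¹' s | mS.comap T₂⟧ := by
  set h : S → ℝ := fun t => (condDistrib Z T₁ μ t).real s with hh
  have hm : Measurable h := (Kernel.measurable_coe _ hs).ennreal_toReal
  have hb : ∀ t, ‖h t‖ ≤ 1 := fun t => by
    rw [Real.norm_of_nonneg measureReal_nonneg]; exact measureReal_le_one
  -- The regular conditional law depends only on the joint law, so a single function `h` serves for
  -- both conditionings.
  have hcd : condDistrib Z T₁ μ = condDistrib Z T₂ μ := by simp only [condDistrib, hmap]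
  have e₁ : h ∘ T₁ =ᵐ[μ] μ⟦Z ⁻¹' s | mS.comap T₁⟧ := condDistrib_ae_eq_condExp hT₁ hZ hs
  have e₂ : h ∘ T₂ =ᵐ[μ] μ⟦Z ⁻¹' s | mS.comap T₂⟧ := by
    simp only [hh, hcd]
    exact condDistrib_ae_eq_condExp hT₂ hZ hs
  have i₁ : Integrable (h ∘ T₁) μ :=
    .of_bound (hm.comp hT₁).aestronglyMeasurable 1 (.of_forall fun ω => hb _)
  have i₂ : Integrable (h ∘ T₂) μ :=
    .of_bound (hm.comp hT₂).aestronglyMeasurable 1 (.of_forall fun ω => hb _)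
  have bmul : ∀ {f g : Ω → S}, Measurable f → Measurable g →
      Integrable ((h ∘ f) * (h ∘ g)) μ := fun {f g} hf hg =>
    .of_bound ((hm.comp hf).mul (hm.comp hg)).aestronglyMeasurable 1 (.of_forall fun ω => by
      simpa using mul_le_one₀ (hb (f ω)) (norm_nonneg _) (hb (g ω)))
  -- `h ∘ T₂` is the L² projection of `h ∘ T₁`, and both have the same second moment since `T₁` and
  -- `T₂` have the same law. By Pythagoras their difference vanishes.
  have tower : μ[h ∘ T₁ | mS.comap T₂] =ᵐ[μ] h ∘ T₂ :=
    (condExp_congr_ae e₁).trans ((condExp_condExp_of_le hle hT₁.comap_le).trans e₂.symm)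
  have law : μ.map T₁ = μ.map T₂ := by
    have := congrArg (Measure.map Prod.fst) hmap
    rwa [Measure.map_map measurable_fst (by fun_prop),
      Measure.map_map measurable_fst (by fun_prop)] at this
  have sq : ∫ ω, ((h ∘ T₁) * (h ∘ T₁)) ω ∂μ = ∫ ω, ((h ∘ T₂) * (h ∘ T₂)) ω ∂μ := by
    have hmm : Measurable fun t => h t * h t := hm.mul hm
    have a₁ := integral_map (μ := μ) hT₁.aemeasurable (f := fun t => h t * h t)
      hmm.aestronglyMeasurable
    have a₂ := integral_map (μ := μ) hT₂.aemeasurable (f := fun t => h t * h t)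
      hmm.aestronglyMeasurable
    simp only [Pi.mul_apply, Function.comp_apply]
    rw [← a₁, ← a₂, law]
  have cross : ∫ ω, ((h ∘ T₁) * (h ∘ T₂)) ω ∂μ = ∫ ω, ((h ∘ T₂) * (h ∘ T₂)) ω ∂μ := by
    rw [← integral_condExp hT₂.comap_le]
    refine integral_congr_ae ?_
    refine (condExp_mul_of_stronglyMeasurable_right ?_ (bmul hT₁ hT₂) i₁).trans ?_
    · exact (hm.comp (comap_measurable T₂)).stronglyMeasurable
    · filter_upwards [tower] with ω hω
      simp only [Pi.mul_apply, hω]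
  have zero : ∫ ω, (h (T₁ ω) - h (T₂ ω)) ^ 2 ∂μ = 0 := by
    have expand : ∀ ω, (h (T₁ ω) - h (T₂ ω)) ^ 2 = ((h ∘ T₁) * (h ∘ T₁)) ω
        - 2 * ((h ∘ T₁) * (h ∘ T₂)) ω + ((h ∘ T₂) * (h ∘ T₂)) ω := fun ω => by
      simp only [Pi.mul_apply, Function.comp_apply]; ring
    simp_rw [expand]
    have isub : Integrable (fun ω => ((h ∘ T₁) * (h ∘ T₁)) ω
        - 2 * ((h ∘ T₁) * (h ∘ T₂)) ω) μ := (bmul hT₁ hT₁).sub ((bmul hT₁ hT₂).const_mul 2)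
    rw [integral_add isub (bmul hT₂ hT₂),
      integral_sub (bmul hT₁ hT₁) ((bmul hT₁ hT₂).const_mul 2), integral_const_mul, sq, cross]
    ring
  have hsqi : Integrable (fun ω => (h (T₁ ω) - h (T₂ ω)) ^ 2) μ := by
    refine .of_bound (((hm.comp hT₁).sub (hm.comp hT₂)).pow_const 2).aestronglyMeasurable 4
      (.of_forall fun ω => ?_)
    have h₁ := abs_le.1 (hb (T₁ ω))
    have h₂ := abs_le.1 (hb (T₂ ω))
    rw [Real.norm_of_nonneg (sq_nonneg _)]
    nlinarith
  have key := (integral_eq_zero_iff_of_nonneg (fun ω => sq_nonneg _) hsqi).1 zero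
  filter_upwards [e₁, e₂, key] with ω h₁ h₂ h₃
  rw [← h₁, ← h₂]
  exact sub_eq_zero.1 (pow_eq_zero_iff (two_ne_zero)|>.1 h₃)

/-! ### Futures of a sequence and conditional independence -/

/-- The sequence `x` without its first `n` elements. -/
def dropSeq (n : ℕ) (x : ℕ → ℝ) : ℕ → ℝ := fun r => x (r + n)

@[fun_prop]
theorem measurable_dropSeq (n : ℕ) : Measurable (dropSeq n) :=
  measurable_pi_lambda _ fun _ => measurable_pi_apply _

/-- The σ-algebra generated by the coordinates from `n` on. -/
abbrev futureSigma (n : ℕ) : MeasurableSpace (ℕ → ℝ) :=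
  MeasurableSpace.comap (dropSeq n) inferInstance

theorem futureSigma_le (n : ℕ) : futureSigma n ≤ MeasurableSpace.pi := (measurable_dropSeq n).comap_le

theorem futureSigma_antitone : Antitone futureSigma := fun m n hmn => by
  have : dropSeq n = dropSeq (n - m) ∘ dropSeq m := by
    funext x r
    simp only [dropSeq, Function.comp_apply]
    congr 1
    omega
  rw [futureSigma, this, ← MeasurableSpace.comap_comp]
  exact MeasurableSpace.comap_mono (measurable_dropSeq _).comap_le

theorem measurable_futureSigma_eval {n r : ℕ} (h : n ≤ r) :
    Measurable[futureSigma n] fun x : ℕ → ℝ => x r := by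
  have : (fun x : ℕ → ℝ => x r) = (fun y => y (r - n)) ∘ dropSeq n := by
    funext x
    simp only [dropSeq, Function.comp_apply]
    congr 1
    omega
  rw [this]
  exact (measurable_pi_apply _).comp (comap_measurable _)

theorem integral_mul_condExp_eq {Ω : Type*} {m m₀ : MeasurableSpace Ω} {μ : Measure Ω}
    [IsFiniteMeasure μ] (hm : m ≤ m₀) {f g : Ω → ℝ} (hf : StronglyMeasurable[m] f)
    (hfg : Integrable (f * g) μ) (hg : Integrable g μ) :
    ∫ ω, f ω * (μ[g | m]) ω ∂μ = ∫ ω, f ω * g ω ∂μ := by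
  have := integral_condExp (μ := μ) hm (f := f * g)
  rw [integral_congr_ae (condExp_mul_of_stronglyMeasurable_left hf hfg hg)] at this
  exact this

/-- If conditioning each of the first `N` coordinates on all the following ones amounts to
conditioning it on the coordinates from `N` on, then the first `N` coordinates are conditionally
independent given the coordinates from `N` on. -/
theorem measure_pi_range_eq_lintegral (L : Measure (ℕ → ℝ)) [IsProbabilityMeasure L] (N : ℕ)
    (A : ℕ → Set ℝ) (hA : ∀ r, MeasurableSet (A r))
    (h : ∀ r < N, L⟦(fun x => x r) ⁻¹' A r | futureSigma (r + 1)⟧ =ᵐ[L]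
      L⟦(fun x => x r) ⁻¹' A r | futureSigma N⟧) :
    L ((Finset.range N : Set ℕ).pi A) =
      ∫⁻ x, ∏ r ∈ Finset.range N,
        condDistrib (fun x : ℕ → ℝ => x r) (dropSeq N) L (dropSeq N x) (A r) ∂L := by
  set M : ℕ → (ℕ → ℝ) → ℝ := fun r x =>
    (condDistrib (fun x : ℕ → ℝ => x r) (dropSeq N) L (dropSeq N x)).real (A r) with hM
  set I : ℕ → (ℕ → ℝ) → ℝ := fun r => ((fun x : ℕ → ℝ => x r) ⁻¹' A r).indicator fun _ => 1
    with hI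
  have mA : ∀ r, MeasurableSet ((fun x : ℕ → ℝ => x r) ⁻¹' A r) := fun r =>
    measurable_pi_apply r (hA r)
  have mM : ∀ r, Measurable[futureSigma N] (M r) := fun r =>
    ((Kernel.measurable_coe _ (hA r)).comp (comap_measurable _)).ennreal_toReal
  have mI : ∀ {n r}, n ≤ r → Measurable[futureSigma n] (I r) := fun {n r} hr =>
    measurable_const.indicator (measurable_futureSigma_eval hr (hA r))
  have M0 : ∀ r x, 0 ≤ M r x := fun r x => measureReal_nonneg
  have M1 : ∀ r x, M r x ≤ 1 := fun r x => measureReal_le_one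
  have I0 : ∀ r x, 0 ≤ I r x := fun r x => Set.indicator_nonneg (fun _ _ => zero_le_one) _
  have I1 : ∀ r x, I r x ≤ 1 := fun r x => Set.indicator_le' (fun _ _ => le_rfl)
    (fun _ _ => zero_le_one) _
  have iI : ∀ r, Integrable (I r) L := fun r => (integrable_const 1).indicator (mA r)
  have MI : ∀ r < N, M r =ᵐ[L] L[I r | futureSigma (r + 1)] := fun r hr =>
    (condDistrib_ae_eq_condExp (measurable_dropSeq N) (measurable_pi_apply r) (hA r)).trans
      (h r hr).symm
  -- Indicators are replaced by conditional probabilities one at a time, from index `0` up. When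
  -- index `m` is treated, every other factor is measurable with respect to the coordinates after
  -- `m`, so `I m` may be replaced by its conditional expectation given them, which is `M m`.
  have step : ∀ m ≤ N, ∫ x, (∏ r ∈ Finset.range m, M r x) * ∏ r ∈ Finset.Ico m N, I r x ∂L =
      ∫ x, ∏ r ∈ Finset.range N, I r x ∂L := by
    intro m
    induction m with
    | zero => intro _; simp
    | succ m ih =>
      intro hm
      rw [← ih (by omega)]
      set F : (ℕ → ℝ) → ℝ := fun x =>
        (∏ r ∈ Finset.range m, M r x) * ∏ r ∈ Finset.Ico (m + 1) N, I r x with hF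
      have mF : Measurable[futureSigma (m + 1)] F := by
        refine Measurable.mul (Finset.measurable_fun_prod _ fun r _ =>
          (mM r).mono (futureSigma_antitone hm) le_rfl) (Finset.measurable_fun_prod _ fun r hr =>
            mI (Finset.mem_Ico.1 hr).1)
      have F0 : ∀ x, 0 ≤ F x := fun x => mul_nonneg (Finset.prod_nonneg fun r _ => M0 r x)
        (Finset.prod_nonneg fun r _ => I0 r x)
      have F1 : ∀ x, F x ≤ 1 := fun x => mul_le_one₀
        (Finset.prod_le_one (fun r _ => M0 r x) fun r _ => M1 r x)
        (Finset.prod_nonneg fun r _ => I0 r x)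
        (Finset.prod_le_one (fun r _ => I0 r x) fun r _ => I1 r x)
      have iFI : Integrable (F * I m) L := by
        refine .of_bound ((mF.mono (futureSigma_le _) le_rfl).mul
          ((mI le_rfl).mono (futureSigma_le m) le_rfl)).aestronglyMeasurable 1
          (.of_forall fun x => ?_)
        rw [Pi.mul_apply, Real.norm_of_nonneg (mul_nonneg (F0 x) (I0 m x))]
        exact mul_le_one₀ (F1 x) (I0 m x) (I1 m x)
      have e₁ : ∀ x, (∏ r ∈ Finset.range (m + 1), M r x) * ∏ r ∈ Finset.Ico (m + 1) N, I r x =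
          F x * M m x := fun x => by rw [Finset.prod_range_succ, hF]; ring
      have e₂ : ∀ x, (∏ r ∈ Finset.range m, M r x) * ∏ r ∈ Finset.Ico m N, I r x =
          F x * I m x := fun x => by
        rw [Finset.prod_eq_prod_Ico_succ_bot (show m < N by omega), hF]; ring
      simp_rw [e₁, e₂]
      rw [← integral_mul_condExp_eq (futureSigma_le (m + 1)) mF.stronglyMeasurable iFI (iI m)]
      refine integral_congr_ae ?_
      filter_upwards [MI m hm] with x hx
      rw [hx]
  have fin := step N le_rfl
  simp only [Finset.Ico_self, Finset.prod_empty, mul_one] at fin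
  have hbox : ∀ x, ∏ r ∈ Finset.range N, I r x =
      ((Finset.range N : Set ℕ).pi A).indicator (fun _ => (1 : ℝ)) x := fun x => by
    by_cases hx : x ∈ (Finset.range N : Set ℕ).pi A
    · rw [Set.indicator_of_mem hx]
      exact Finset.prod_eq_one fun r hr => Set.indicator_of_mem (s := (fun x : ℕ → ℝ => x r) ⁻¹' A r)
        (hx r hr) _
    · rw [Set.indicator_of_notMem hx]
      simp only [Set.mem_pi, not_forall] at hx
      obtain ⟨r, hr, hxr⟩ := hx
      exact Finset.prod_eq_zero hr
        (Set.indicator_of_notMem (s := (fun x : ℕ → ℝ => x r) ⁻¹' A r) hxr _)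
  have mbox : MeasurableSet ((Finset.range N : Set ℕ).pi A) :=
    MeasurableSet.pi (Finset.countable_toSet _) fun r _ => hA r
  simp_rw [hbox] at fin
  rw [integral_indicator_const _ mbox, smul_eq_mul, mul_one] at fin
  rw [← ENNReal.ofReal_toReal (measure_ne_top L _), ← measureReal_def, ← fin,
    ofReal_integral_eq_lintegral_ofReal]
  · refine lintegral_congr fun x => ?_
    rw [ENNReal.ofReal_prod_of_nonneg fun r _ => M0 r x]
    refine Finset.prod_congr rfl fun r _ => ?_
    rw [hM, ofReal_measureReal]
  · refine .of_bound (Finset.measurable_fun_prod _ fun r _ =>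
      (mM r).mono (futureSigma_le N) le_rfl).aestronglyMeasurable 1 (.of_forall fun x => ?_)
    rw [Real.norm_of_nonneg (Finset.prod_nonneg fun r _ => M0 r x)]
    exact Finset.prod_le_one (fun r _ => M0 r x) fun r _ => M1 r x
  · exact .of_forall fun x => Finset.prod_nonneg fun r _ => M0 r x

/-! ### De Finetti's theorem within residue classes -/

@[fun_prop]
theorem measurable_swapSeq {p : ℕ} (i : Fin p) (j k : ℕ) : Measurable (swapSeq i j k) :=
  measurable_pi_lambda _ fun _ => measurable_pi_apply _

/-- Swap-invariance within the residue classes modulo `p` implies invariance under every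
re-indexing that is injective and preserves residues modulo `p`. -/
theorem map_comp_eq_of_swap_invariant {p : ℕ} (hp : 0 < p) (L : Measure (ℕ → ℝ))
    [IsProbabilityMeasure L] (hL : ∀ (i : Fin p) (j k : ℕ), L.map (swapSeq i j k) = L)
    {ρ : ℕ → ℕ} (hρ : Function.Injective ρ) (hmod : ∀ r, ρ r % p = r % p) :
    L.map (fun x r => x (ρ r)) = L := by
  classical
  have mcomp : ∀ σ : ℕ → ℕ, Measurable fun (x : ℕ → ℝ) r => x (σ r) := fun σ =>
    measurable_pi_lambda _ fun _ => measurable_pi_apply _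
  -- `ρ` need not be surjective, but a box sees only finitely many indices, and there `ρ` agrees
  -- with a finite product of allowed swaps.
  have approx : ∀ s : Finset ℕ, ∃ σ : Equiv.Perm ℕ, (∀ r ∈ s, σ r = ρ r) ∧
      (∀ r, σ r % p = r % p) ∧ L.map (fun x r => x (σ r)) = L := by
    intro s
    induction s using Finset.induction_on with
    | empty => exact ⟨1, by simp, by simp, by simp⟩
    | insert a s ha ih =>
      obtain ⟨σ, hσ, hσp, hσL⟩ := ih
      have split : ∀ n, n % p = a % p → n = n / p * p + a % p := fun n hn => by
        rw [← hn, mul_comm, Nat.div_add_mod]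
      have e₁ := split _ (hσp a)
      have e₂ := split _ (hmod a)
      -- The new swap sends `σ a` to `ρ a`; injectivity of `σ` and `ρ` keeps it away from the values
      -- already correct on `s`.
      refine ⟨Equiv.swap (σ a) (ρ a) * σ, ?_, ?_, ?_⟩
      · intro r hr
        rw [Equiv.Perm.mul_apply]
        rcases eq_or_ne r a with rfl | hra
        · exact Equiv.swap_apply_left _ _
        · have hrs : r ∈ s := (Finset.mem_insert.1 hr).resolve_left hra
          rw [Equiv.swap_apply_of_ne_of_ne (σ.injective.ne hra)
            (by rw [hσ r hrs]; exact hρ.ne hra), hσ r hrs]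
      · intro r
        rw [Equiv.Perm.mul_apply, ← hσp r, Equiv.swap_apply_def]
        split_ifs with h₁ h₂
        · rw [h₁, hσp, hmod]
        · rw [h₂, hσp, hmod]
        · rfl
      · have hsw := hL ⟨a % p, Nat.mod_lt _ hp⟩ (ρ a / p) (σ a / p)
        have hfun : (fun (x : ℕ → ℝ) r => x ((Equiv.swap (σ a) (ρ a) * σ) r)) =
            (fun x r => x (σ r)) ∘ swapSeq ⟨a % p, Nat.mod_lt _ hp⟩ (ρ a / p) (σ a / p) := by
          funext x r
          simp only [Function.comp_apply, swapSeq, Equiv.Perm.mul_apply]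
          rw [← e₁, ← e₂]
        rw [hfun, ← Measure.map_map (mcomp σ) (measurable_swapSeq _ _ _), hsw, hσL]
  have := Measure.isProbabilityMeasure_map (μ := L) (mcomp ρ).aemeasurable
  refine ext_of_finset_pi fun s t ht => ?_
  obtain ⟨σ, hσ, -, hσL⟩ := approx s
  have mbox : MeasurableSet ((s : Set ℕ).pi t) :=
    MeasurableSet.pi (Finset.countable_toSet _) fun r _ => ht r
  conv_rhs => rw [← hσL]
  rw [Measure.map_apply (mcomp _) mbox, Measure.map_apply (mcomp _) mbox]
  congr 1
  ext x
  simp only [Set.mem_preimage, Set.mem_pi]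
  exact forall₂_congr fun r hr => by rw [hσ r hr]

/-- The de Finetti representation of the first `2p` elements of a sequence of which the law is
invariant under swaps within the residue classes modulo `p`; the mixture is directed by the
elements from `2p` on. -/
theorem measure_pi_range_eq_lintegral_of_swap_invariant {p : ℕ} (hp : 0 < p)
    (L : Measure (ℕ → ℝ)) [IsProbabilityMeasure L]
    (hL : ∀ (i : Fin p) (j k : ℕ), L.map (swapSeq i j k) = L)
    (A : ℕ → Set ℝ) (hA : ∀ r, MeasurableSet (A r)) :
    L ((Finset.range (p + p) : Set ℕ).pi A) =
      ∫⁻ x, ∏ r ∈ Finset.range (p + p),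
        condDistrib (fun x : ℕ → ℝ => x (r % p)) (dropSeq (p + p)) L
          (dropSeq (p + p) x) (A r) ∂L := by
  have minj : ∀ ρ : ℕ → ℕ, Measurable fun (x : ℕ → ℝ) r => x (ρ r) := fun σ =>
    measurable_pi_lambda _ fun _ => measurable_pi_apply _
  have joint : ∀ {ρ : ℕ → ℕ}, Function.Injective ρ → (∀ r, ρ r % p = r % p) →
      ∀ {T : (ℕ → ℝ) → ℕ → ℝ} (r : ℕ), Measurable T →
      L.map (fun x => (T x, x r)) = L.map (fun x => (T fun s => x (ρ s), x (ρ r))) := by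
    intro ρ hρ hmod T r hT
    conv_lhs => rw [← map_comp_eq_of_swap_invariant hp L hL hρ hmod]
    rw [Measure.map_map (hT.prodMk (measurable_pi_apply r)) (minj ρ)]
    rfl
  rw [measure_pi_range_eq_lintegral L (p + p) A hA]
  · refine lintegral_congr fun x => Finset.prod_congr rfl fun r hr => ?_
    suffices condDistrib (fun x : ℕ → ℝ => x r) (dropSeq (p + p)) L =
        condDistrib (fun x : ℕ → ℝ => x (r % p)) (dropSeq (p + p)) L by rw [this]
    have hrp := Finset.mem_range.1 hr
    have hlt := Nat.mod_lt r hp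
    -- Both `r` and `r % p` are below `2p`, so this swap leaves the conditioning block untouched.
    have := joint (ρ := Equiv.swap r (r % p)) (Equiv.injective _) (fun s => by
      rw [Equiv.swap_apply_def]
      split_ifs with h₁ h₂
      · rw [h₁, Nat.mod_mod]
      · rw [h₂, Nat.mod_mod]
      · rfl) r (measurable_dropSeq (p + p))
    simp only [Equiv.swap_apply_left] at this
    have hdrop : ∀ x : ℕ → ℝ, dropSeq (p + p) (fun s => x (Equiv.swap r (r % p) s)) =
        dropSeq (p + p) x := fun x => by
      funext s
      simp only [dropSeq]
      rw [Equiv.swap_apply_of_ne_of_ne (by omega) (by omega)]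
    simp only [hdrop] at this
    simp only [condDistrib, this]
  · intro r hr
    -- This opens a gap of length `2p` after `r`; residues are kept because `2p` is a multiple of
    -- `p`.
    have hmap := joint (ρ := fun s => if s ≤ r then s else s + (p + p))
      (fun a b hab => by beta_reduce at hab; split_ifs at hab <;> omega) (fun s => by
        split_ifs
        · rfl
        · rw [← two_mul, Nat.add_mul_mod_self_right]) r (measurable_dropSeq (r + 1))
    have hfun : (fun x : ℕ → ℝ => dropSeq (r + 1) fun s =>
        x (if s ≤ r then s else s + (p + p))) = dropSeq (r + 1 + (p + p)) := by
      funext x s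
      simp only [dropSeq]
      rw [if_neg (by omega), add_assoc]
    have hmap' : L.map (fun x => (dropSeq (r + 1) x, x r)) =
        L.map (fun x => (dropSeq (r + 1 + (p + p)) x, x r)) := by
      rw [hmap, ← hfun]
      simp
    have key := condExp_ae_eq_of_map_prodMk_eq (measurable_pi_apply r)
      (measurable_dropSeq (r + 1)) (measurable_dropSeq (r + 1 + (p + p))) hmap'
      (futureSigma_antitone (by omega)) (hA r)
    -- The future from `2p` on lies between the two futures just compared, since `r < 2p`.
    -- Conditioning on it must therefore give the same result.
    have lower : futureSigma (r + 1 + (p + p)) ≤ futureSigma (p + p) :=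
      futureSigma_antitone (by omega)
    have upper : futureSigma (p + p) ≤ futureSigma (r + 1) := futureSigma_antitone (by omega)
    have tower := condExp_condExp_of_le (μ := L)
      (f := ((fun x : ℕ → ℝ => x r) ⁻¹' A r).indicator fun _ => (1 : ℝ)) upper
      (futureSigma_le (r + 1))
    refine key.trans (Filter.EventuallyEq.trans ?_ ((condExp_congr_ae key).symm.trans tower))
    rw [condExp_of_stronglyMeasurable (futureSigma_le (p + p))
      (stronglyMeasurable_condExp.mono lower) integrable_condExp]

/-! ### Mixtures of product laws on sequences -/

/-- The mixture over `γ` of the laws of sequences with independent elements of laws `Q r θ`. -/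
noncomputable def mixedProduct {Θ : Type*} [MeasurableSpace Θ] (γ : Measure Θ)
    (Q : ℕ → Kernel Θ ℝ) [∀ r, IsMarkovKernel (Q r)] : Measure (ℕ → ℝ) :=
  γ.bind fun θ => Measure.infinitePi fun r => Q r θ

theorem measurable_infinitePi_kernel {Θ : Type*} [MeasurableSpace Θ]
    (Q : ℕ → Kernel Θ ℝ) [∀ r, IsMarkovKernel (Q r)] :
    Measurable fun θ => Measure.infinitePi fun r => Q r θ := by
  refine Measurable.measure_of_isPiSystem_of_isProbabilityMeasure
    generateFrom_squareCylinders.symm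
    (isPiSystem_squareCylinders (fun _ => MeasurableSpace.isPiSystem_measurableSet) (by simp)) ?_
  rintro _ ⟨s, t, ht, rfl⟩
  have ht' : ∀ r, MeasurableSet (t r) := fun r => ht r (Set.mem_univ r)
  simp_rw [Measure.infinitePi_pi _ fun r _ => ht' r]
  exact Finset.measurable_fun_prod _ fun r _ => Kernel.measurable_coe _ (ht' r)

section MixedProduct

variable {Θ : Type*} [MeasurableSpace Θ] (γ : Measure Θ)
    (Q : ℕ → Kernel Θ ℝ) [∀ r, IsMarkovKernel (Q r)]

theorem mixedProduct_pi (s : Finset ℕ) {t : ℕ → Set ℝ} (ht : ∀ r, MeasurableSet (t r)) :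
    mixedProduct γ Q ((s : Set ℕ).pi t) = ∫⁻ θ, ∏ r ∈ s, Q r θ (t r) ∂γ := by
  rw [mixedProduct, Measure.bind_apply
    (MeasurableSet.pi (Finset.countable_toSet _) fun r _ => ht r)
    (measurable_infinitePi_kernel Q).aemeasurable]
  simp_rw [Measure.infinitePi_pi _ fun r _ => ht r]

instance [IsProbabilityMeasure γ] : IsProbabilityMeasure (mixedProduct γ Q) := ⟨by
  have := mixedProduct_pi γ Q ∅ (t := fun _ => Set.univ) fun _ => MeasurableSet.univ
  simpa using this⟩

theorem mixedProduct_map_comp_perm [IsProbabilityMeasure γ] (σ : Equiv.Perm ℕ)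
    (hσ : ∀ r, Q (σ r) = Q r) :
    (mixedProduct γ Q).map (fun x r => x (σ r)) = mixedProduct γ Q := by
  have mσ : Measurable fun (x : ℕ → ℝ) r => x (σ r) :=
    measurable_pi_lambda _ fun _ => measurable_pi_apply _
  have := Measure.isProbabilityMeasure_map (μ := mixedProduct γ Q) mσ.aemeasurable
  refine ext_of_finset_pi fun s t ht => ?_
  rw [Measure.map_apply mσ (MeasurableSet.pi (Finset.countable_toSet _) fun r _ => ht r)]
  have : (fun (x : ℕ → ℝ) r => x (σ r)) ⁻¹' (s : Set ℕ).pi t =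
      ((s.map σ.toEmbedding : Finset ℕ) : Set ℕ).pi fun r => t (σ.symm r) := by
    ext x
    simp only [Set.mem_preimage, Set.mem_pi, Finset.mem_coe, Finset.mem_map_equiv]
    exact ⟨fun h r hr => by simpa using h _ hr, fun h r hr => by simpa using h (σ r) (by simpa)⟩
  rw [this, mixedProduct_pi γ Q _ fun r => ht _, mixedProduct_pi γ Q _ ht]
  simp [Finset.prod_map, hσ]

end MixedProduct

/-! ### Boxes for the first `2p` coordinates -/

/-- The sequence of sets `A₀, …, A_{p-1}, B₀, …, B_{p-1}`, continued by the whole line. -/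
def boxSeq {p : ℕ} (A B : Fin p → Set ℝ) (r : ℕ) : Set ℝ :=
  if h : r < p + p then Fin.append A B ⟨r, h⟩ else Set.univ

section BoxSeq

variable {p : ℕ} {A B : Fin p → Set ℝ}

theorem boxSeq_coe (r : Fin (p + p)) : boxSeq A B r = Fin.append A B r := by
  simp [boxSeq]

theorem measurableSet_boxSeq (hA : ∀ i, MeasurableSet (A i)) (hB : ∀ i, MeasurableSet (B i))
    (r : ℕ) : MeasurableSet (boxSeq A B r) := by
  rw [boxSeq]
  split_ifs with h
  · generalize (⟨r, h⟩ : Fin (p + p)) = q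
    induction q using Fin.addCases with
    | left i => simpa using hA i
    | right i => rw [Fin.append_right]; exact hB i
  · exact MeasurableSet.univ

theorem preimage_univ_pi_append :
    (fun (x : ℕ → ℝ) (r : Fin (p + p)) => x r) ⁻¹' Set.univ.pi (Fin.append A B) =
      (Finset.range (p + p) : Set ℕ).pi (boxSeq A B) := by
  ext x
  simp only [Set.mem_preimage, Set.mem_pi, Set.mem_univ, forall_const, Finset.coe_range,
    Set.mem_Iio]
  refine ⟨fun h r hr => ?_, fun h r => ?_⟩
  · have := h ⟨r, hr⟩
    rwa [← boxSeq_coe] at this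
  · rw [← boxSeq_coe]
    exact h r r.2

theorem joinVec_preimage_univ_pi_append {Ω : Type u} (X Xt : Ω → Fin p → ℝ) :
    joinVec X Xt ⁻¹' Set.univ.pi (Fin.append A B) =
      {ω | (∀ i, X ω i ∈ A i) ∧ (∀ i, Xt ω i ∈ B i)} := by
  ext ω
  simp only [joinVec, Set.mem_preimage, Set.mem_pi, Set.mem_univ, forall_const, Set.mem_ofPred_eq]
  refine ⟨fun h => ⟨fun i => ?_, fun i => ?_⟩, fun h r => ?_⟩
  · simpa using h (Fin.castAdd p i)
  · have := h (Fin.natAdd p i)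
    rwa [Fin.append_right, Fin.append_right] at this
  · induction r using Fin.addCases with
    | left i => simpa using h.1 i
    | right i => rw [Fin.append_right, Fin.append_right]; exact h.2 i

/-- Positions `i` and `p + i` share the residue `i`, so they pair up into the two factors of the
knockoff formula. -/
theorem prod_range_boxSeq {F : ℕ → Set ℝ → ENNReal} :
    ∏ r ∈ Finset.range (p + p), F (r % p) (boxSeq A B r) =
      ∏ i : Fin p, (F i (A i) * F i (B i)) := by
  rw [Finset.prod_range, Fin.prod_univ_add, ← Finset.prod_mul_distrib]
  refine Finset.prod_congr rfl fun i _ => ?_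
  rw [boxSeq_coe, boxSeq_coe, Fin.append_left, Fin.append_right]
  simp [Nat.mod_eq_of_lt i.2]

end BoxSeq

theorem measurable_joinVec {Ω : Type u} [MeasurableSpace Ω] {p : ℕ} {X Xt : Ω → Fin p → ℝ}
    (hX : Measurable X) (hXt : Measurable Xt) : Measurable (joinVec X Xt) := by
  refine measurable_pi_lambda _ fun r => ?_
  induction r using Fin.addCases with
  | left i =>
    simp only [joinVec, Fin.append_left]
    exact (measurable_pi_apply i).comp hX
  | right i =>
    simp only [joinVec, Fin.append_right]
    exact (measurable_pi_apply i).comp hXt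

/-! ### The two implications -/

theorem isCIK_of_infinitelyExtendable {Ω : Type u} [MeasurableSpace Ω] (μ : Measure Ω)
    [IsProbabilityMeasure μ] {p : ℕ} (hp : 0 < p) (X Xt : Ω → Fin p → ℝ)
    (h : InfinitelyExtendable.{u, v} X Xt μ) : IsCIK.{u, w} X Xt μ := by
  obtain ⟨Ω', _, ν, V, _, hV, hlaw, hswap⟩ := h
  set L : Measure (ℕ → ℝ) := ν.map V with hLdef
  have : IsProbabilityMeasure L := Measure.isProbabilityMeasure_map hV.aemeasurable
  have hL : ∀ (i : Fin p) (j k : ℕ), L.map (swapSeq i j k) = L := fun i j k => by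
    rw [hLdef, Measure.map_map (measurable_swapSeq i j k) hV]
    exact (hswap i j k).map_eq
  let K : ℕ → Kernel (ℕ → ℝ) ℝ := fun r =>
    condDistrib (fun x : ℕ → ℝ => x r) (dropSeq (p + p)) L
  -- `Θ` is the space of sequences, `γ` the law of the block from `2p` on, and the kernels are the
  -- conditional laws given that block; `ULift` only adjusts the universe.
  refine ⟨ULift.{w} (ℕ → ℝ), inferInstance, L.map (ULift.up ∘ dropSeq (p + p)),
    fun i => (K i).comap ULift.down measurable_down,
    Measure.isProbabilityMeasure_map (measurable_up.comp (measurable_dropSeq _)).aemeasurable,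
    fun i => inferInstance, fun A B hA hB => ?_⟩
  have mAB := measurableSet_boxSeq hA hB
  have mres : Measurable fun (x : ℕ → ℝ) (r : Fin (p + p)) => x r :=
    measurable_pi_lambda _ fun _ => measurable_pi_apply _
  have mbox : MeasurableSet (Set.univ.pi (Fin.append A B)) :=
    MeasurableSet.univ_pi fun r => by rw [← boxSeq_coe]; exact mAB r
  have hjoin : μ.map (joinVec X Xt) = L.map fun x (r : Fin (p + p)) => x r := by
    rw [← hlaw.map_eq, hLdef, Measure.map_map mres hV]
    rfl
  rw [← joinVec_preimage_univ_pi_append, ← Measure.map_apply_of_aemeasurable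
    hlaw.aemeasurable_snd mbox, hjoin, Measure.map_apply mres mbox, preimage_univ_pi_append,
    measure_pi_range_eq_lintegral_of_swap_invariant hp L hL _ mAB,
    lintegral_map (f := fun θ : ULift (ℕ → ℝ) => ∏ i : Fin p,
      ((K i).comap ULift.down measurable_down θ (A i) *
        (K i).comap ULift.down measurable_down θ (B i)))
      (Finset.measurable_fun_prod _ fun i _ =>
        (Kernel.measurable_coe _ (hA i)).mul (Kernel.measurable_coe _ (hB i)))
      (measurable_up.comp (measurable_dropSeq _))]
  refine lintegral_congr fun x => ?_
  simp only [Kernel.comap_apply, Function.comp_apply]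
  exact prod_range_boxSeq (F := fun r => K r (dropSeq (p + p) x))

theorem infinitelyExtendable_of_isCIK {Ω : Type u} [MeasurableSpace Ω] (μ : Measure Ω)
    [IsProbabilityMeasure μ] {p : ℕ} (hp : 0 < p) (X Xt : Ω → Fin p → ℝ)
    (hX : Measurable X) (hXt : Measurable Xt)
    (h : IsCIK.{u, w} X Xt μ) : InfinitelyExtendable.{u, v} X Xt μ := by
  obtain ⟨Θ, _, γ, P, _, _, hP⟩ := h
  -- The periodic continuation of the kernels makes positions of equal residue exchangeable.
  let Q : ℕ → Kernel Θ ℝ := fun r => P ⟨r % p, Nat.mod_lt r hp⟩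
  have hQ : ∀ r, IsMarkovKernel (Q r) := fun r => by dsimp only [Q]; infer_instance
  set L := mixedProduct γ Q with hLdef
  have mcomp : ∀ σ : ℕ → ℕ, Measurable fun (x : ℕ → ℝ) r => x (σ r) := fun σ =>
    measurable_pi_lambda _ fun _ => measurable_pi_apply _
  have mres : Measurable fun (x : ℕ → ℝ) (r : Fin (p + p)) => x r :=
    measurable_pi_lambda _ fun _ => measurable_pi_apply _
  have down : (L.map ULift.up.{v}).map ULift.down = L := by
    rw [Measure.map_map measurable_down measurable_up]
    exact Measure.map_id
  have lift : ∀ {β : Type} [MeasurableSpace β] {f : (ℕ → ℝ) → β}, Measurable f →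
      (L.map ULift.up.{v}).map (fun x => f x.down) = L.map f := fun {β _ f} hf => by
    conv_rhs => rw [← down]
    rw [Measure.map_map hf measurable_down]
    rfl
  refine ⟨ULift.{v} (ℕ → ℝ), inferInstance, L.map ULift.up, ULift.down,
    Measure.isProbabilityMeasure_map measurable_up.aemeasurable, measurable_down,
    ⟨(mres.comp measurable_down).aemeasurable, (measurable_joinVec hX hXt).aemeasurable, ?_⟩,
    fun i j k => ⟨((mcomp _).comp measurable_down).aemeasurable,
      measurable_down.aemeasurable, ?_⟩⟩
  · rw [lift mres]
    have := Measure.isProbabilityMeasure_map (μ := L) mres.aemeasurable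
    have := Measure.isProbabilityMeasure_map (μ := μ) (measurable_joinVec hX hXt).aemeasurable
    refine ext_of_univ_pi fun t ht => ?_
    obtain ⟨A, B, rfl⟩ : ∃ A B : Fin p → Set ℝ, Fin.append A B = t :=
      ⟨fun i => t (Fin.castAdd p i), fun i => t (Fin.natAdd p i), Fin.append_castAdd_natAdd⟩
    have hA : ∀ i, MeasurableSet (A i) := fun i => by
      have := ht (Fin.castAdd p i)
      rwa [Fin.append_left] at this
    have hB : ∀ i, MeasurableSet (B i) := fun i => by
      have := ht (Fin.natAdd p i)
      rwa [Fin.append_right] at this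
    have mbox := MeasurableSet.univ_pi ht
    rw [Measure.map_apply mres mbox, Measure.map_apply (measurable_joinVec hX hXt) mbox,
      preimage_univ_pi_append, joinVec_preimage_univ_pi_append, hP A B hA hB, hLdef,
      mixedProduct_pi γ Q _ (measurableSet_boxSeq hA hB)]
    refine lintegral_congr fun θ => ?_
    have := prod_range_boxSeq (A := A) (B := B) (F := fun r => Q r θ)
    simp only [Q, Nat.mod_mod, Nat.mod_eq_of_lt (Fin.is_lt _), Fin.eta] at this
    exact this
  · rw [down]
    refine (lift (mcomp _)).trans (mixedProduct_map_comp_perm γ Q _ fun r => ?_)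
    have hjk : ∀ n : ℕ, (n * p + i) % p = i % p := fun n => by
      rw [mul_comm, Nat.mul_add_mod]
    have : (Equiv.swap (k * p + i) (j * p + i) r) % p = r % p := by
      rw [Equiv.swap_apply_def]
      split_ifs with h₁ h₂
      · rw [h₁, hjk, hjk]
      · rw [h₂, hjk, hjk]
      · rfl
    simp only [Q, this]

/-- Vectors without coordinates are conditional independence knockoffs of each other. -/
theorem isCIK_zero {Ω : Type u} [MeasurableSpace Ω] (μ : Measure Ω) [IsProbabilityMeasure μ]
    (X Xt : Ω → Fin 0 → ℝ) : IsCIK.{u, w} X Xt μ :=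
  ⟨PUnit, inferInstance, Measure.dirac PUnit.unit, fun i => i.elim0, inferInstance,
    fun i => i.elim0, by simp⟩

theorem infinitelyExtendable_zero {Ω : Type u} [MeasurableSpace Ω] (μ : Measure Ω)
    [IsProbabilityMeasure μ] (X Xt : Ω → Fin 0 → ℝ) : InfinitelyExtendable.{u, v} X Xt μ := by
  have hm : Measurable (joinVec X Xt) := measurable_pi_lambda _ fun r => r.elim0
  have := Measure.isProbabilityMeasure_map (μ := μ) hm.aemeasurable
  refine ⟨PUnit, inferInstance, Measure.dirac PUnit.unit, fun _ _ => 0, inferInstance,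
    measurable_const, ⟨measurable_const.aemeasurable, hm.aemeasurable, ?_⟩, fun i => i.elim0⟩
  have := Measure.isProbabilityMeasure_map (μ := Measure.dirac PUnit.unit)
    (f := fun (_ : PUnit) (_ : Fin (0 + 0)) => (0 : ℝ)) measurable_const.aemeasurable
  refine ext_of_univ_pi fun t _ => ?_
  have : Set.univ.pi t = Set.univ := by
    ext x
    simp only [Set.mem_pi, Set.mem_univ, forall_const, iff_true]
    exact fun r => r.elim0
  rw [this, measure_univ, measure_univ]

theorem theorem3 {Ω : Type u} [MeasurableSpace Ω] (μ : Measure Ω) [IsProbabilityMeasure μ]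
    {p : ℕ} (X Xt : Ω → Fin p → ℝ) (Y : Ω → ℝ)
    (hX : Measurable X) (hXt : Measurable Xt) (hY : Measurable Y)
    (hK : IsKnockoff X Xt Y μ) :
    IsCIK.{u, w} X Xt μ ↔ InfinitelyExtendable.{u, v} X Xt μ := by
  -- Residues modulo `p` lie in `Fin p` only for `p > 0`; without coordinates both conditions hold
  -- trivially.
  rcases Nat.eq_zero_or_pos p with rfl | hp
  · exact iff_of_true (isCIK_zero μ X Xt) (infinitelyExtendable_zero μ X Xt)
  · exact ⟨infinitelyExtendable_of_isCIK μ hp X Xt hX hXt,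
      isCIK_of_infinitelyExtendable μ hp X Xt⟩
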